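/- Let $P$ be a finite partially ordered set. For an integer $k\ge 0$, a *chain $k$-family* in $P$ is a collection $\mathcal C$ of exactly $k$ pairwise disjoint nonempty chains (totally ordered subsets) of $P$; it is *maximal* if $|\bigcup\mathcal C|\ge|\bigcup\mathcal D|$ for every chain $k$-family $\mathcal D$ in $P$. The *comparability graph* $\mathrm{Comp}(P)$ is the undirected graph with vertex set $P$ in which two distinct elements are adjacent if and only if they are comparable. For a chain family $\mathcal C$ let $$\overline{\mathcal C}=\{\{x,y\} : x \text{ covers } y \text{ in some chain } C\in\mathcal C\}$$ (that is, $x,y\in C$, $y<x$, and no $z\in C$ satisfies $y<z<x$), a set of edges of $\mathrm{Comp}(P)$. Here a *path* in $\mathrm{Comp}(P)$ is a walk of positive length that uses no edge more than once; it may pass through a vertex more than once, and its two endpoints may coincide. Write $\mathcal X\triangle\mathcal Y=(\mathcal X\setminus\mathcal Y)\cup(\mathcal Y\setminus\mathcal X)$. 1. Let $k\ge 0$ and let $\mathcal C$ be a maximal chain $k$-family in $P$ with $\bigcup\mathcal C\ne P$. Then there is a maximal chain $(k+1)$-family $\mathcal C'$ such that either $\overline{\mathcal C'}=\overline{\mathcal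 C}\,\triangle\,\mathcal M$, where $\mathcal M$ is the edge set of some path in $\mathrm{Comp}(P)$, or $\mathcal C'=\mathcal C\cup\{\{p\}\}$ for some $p\in P\setminus\bigcup\mathcal C$. 2. Let $k>0$ and let $\mathcal C$ be a maximal chain $k$-family in $P$. Then there is a maximal chain $(k-1)$-family $\mathcal C'$ such that either $\overline{\mathcal C'}=\overline{\mathcal C}\,\triangle\,\mathcal M$, where $\mathcal M$ is the edge set of some path in $\mathrm{Comp}(P)$, or $\mathcal C'=\mathcal C\setminus\{\{p\}\}$ for some one-element chain $\{p\}\in\mathcal C$. -/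

import Mathlib

namespace GreeneKleitman

/-- The comparability graph of a poset: two distinct elements are adjacent when they are
comparable. -/
def comparabilityGraph (P : Type*) [PartialOrder P] : SimpleGraph P where
  Adj x y := x < y ∨ y < x
  symm := ⟨fun _ _ h => h.symm⟩
  loopless := ⟨fun _ h => h.elim (lt_irrefl _) (lt_irrefl _)⟩

/-- A chain `k`-family: a collection of exactly `k` pairwise disjoint nonempty chains.
(`Set.Finite` is automatic in a finite poset; it makes `ncard` an honest count.) -/
structure IsChainFamily {P : Type*} [PartialOrder P] (k : ℕ) (C : Set (Set P)) : Prop where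
  finite : C.Finite
  nonempty : ∀ A ∈ C, A.Nonempty
  isChain : ∀ A ∈ C, IsChain (· ≤ ·) A
  disjoint : ∀ A ∈ C, ∀ B ∈ C, A ≠ B → Disjoint A B
  ncard_eq : C.ncard = k

/-- A maximal chain `k`-family: among all chain `k`-families it covers the largest possible
number of elements. -/
def IsMaximalChainFamily {P : Type*} [PartialOrder P] (k : ℕ) (C : Set (Set P)) : Prop :=
  IsChainFamily k C ∧ ∀ D : Set (Set P), IsChainFamily k D → (⋃₀ D).ncard ≤ (⋃₀ C).ncard

/-- `x` covers `y` in the chain `A`: both lie in `A`, `y < x`, and no element of `A` lies strictly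
between them (elements of the poset outside `A` may). -/
def CoversIn {P : Type*} [PartialOrder P] (A : Set P) (x y : P) : Prop :=
  x ∈ A ∧ y ∈ A ∧ y < x ∧ ∀ z ∈ A, ¬ (y < z ∧ z < x)

/-- The set of edges of the comparability graph associated to a chain family: the pairs `{x, y}`
such that `x` covers `y` in some chain of the family. -/
def chainEdges {P : Type*} [PartialOrder P] (C : Set (Set P)) : Set (Sym2 P) :=
  {e | ∃ A ∈ C, ∃ x y : P, CoversIn A x y ∧ e = s(x, y)}

/-- The edge set of `C'` is the symmetric difference of the edge set of `C` with the edge set of a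
path of positive length in the comparability graph. A path is a walk that uses no edge twice;
it may be closed and may return to a vertex. -/
def DiffersByPath {P : Type*} [PartialOrder P] (C C' : Set (Set P)) : Prop :=
  ∃ (u v : P) (M : (comparabilityGraph P).Walk u v),
    M.IsTrail ∧ 0 < M.length ∧
      chainEdges C' = symmDiff (chainEdges C) {e | e ∈ M.edges}

end GreeneKleitman

/-!
A chain family `C` is encoded by the relation `M` on `P` in which every point that is not the least
of its chain is related to the point it covers there, and every point outside `⋃₀ C` to itself. The
relations that arise are the matchings of the bipartite graph of `≥` on two copies of `P`: the
chains correspond to the unmatched upper points, and the uncovered points to the loops. A maximal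
`k`-family is thus a matching with `k` unmatched upper points and the least number of loops.

Let `M` and `N` be optimal with `k` and `k + 1` unmatched upper points. Following `M` and `N`
alternately from a suitable upper point unmatched by `N` yields a path that meets no upper point
unmatched by `M`. Switching `M` and `N` along this path moves one unmatched upper point from `N` to
`M` and preserves the total number of loops, so both results are again optimal. Projected to `P`,
the path is a trail, once its loops are dropped; if nothing else is left, then the path is a single
loop and the switch adds a one-element chain.
-/

namespace GreeneKleitman

open Relation Relator

section Relations

variable {α : Type*} {R : α → α → Prop} {a b c : α}

theorem reflTransGen_total_of_leftUnique (hR : LeftUnique R) (hac : ReflTransGen R a c)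
    (hbc : ReflTransGen R b c) : ReflTransGen R a b ∨ ReflTransGen R b a := by
  have hR' : RightUnique (Function.swap R) := fun _ _ _ h h' => hR h h'
  simpa only [reflTransGen_swap, or_comm] using
    ReflTransGen.total_of_right_unique hR' (reflTransGen_swap.2 hac) (reflTransGen_swap.2 hbc)

theorem eq_of_reflTransGen_of_source (hb : ∀ x, ¬ R x b) (h : ReflTransGen R a b) : a = b :=
  h.cases_tail.elim Eq.symm fun ⟨x, _, hx⟩ => absurd hx (hb x)

theorem source_eq_of_reflTransGen (hR : LeftUnique R) (ha : ∀ x, ¬ R x a) (hb : ∀ x, ¬ R x b)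
    (hac : ReflTransGen R a c) (hbc : ReflTransGen R b c) : a = b :=
  (reflTransGen_total_of_leftUnique hR hac hbc).elim (eq_of_reflTransGen_of_source hb)
    fun h => (eq_of_reflTransGen_of_source ha h).symm

theorem not_transGen_self_of_source (hR : LeftUnique R) (ha : ∀ x, ¬ R x a)
    (hac : ReflTransGen R a c) : ¬ TransGen R c c := by
  induction hac with
  | refl =>
    intro h
    obtain ⟨x, -, hx⟩ := TransGen.tail'_iff.1 h
    exact ha x hx
  | tail _ hbc ih =>
    intro h
    obtain ⟨x, hcx, hxc⟩ := TransGen.tail'_iff.1 h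
    exact ih (.head' hbc (hR hxc hbc ▸ hcx))

theorem reflTransGen_iff_eq_or_of_rightUnique (hR : RightUnique R) (hab : R a b) :
    ReflTransGen R a c ↔ c = a ∨ ReflTransGen R b c := by
  rw [ReflTransGen.cases_head_iff, eq_comm]
  exact or_congr_right
    ⟨fun ⟨_, hax, hxc⟩ => hR hax hab ▸ hxc, fun hbc => ⟨b, hab, hbc⟩⟩

theorem exists_isChain_nodup_forall_mem_iff [Finite α] (hR : RightUnique R)
    (hacyclic : ∀ c, ReflTransGen R a c → ¬ TransGen R c c) :
    ∃ l : List α, (a :: l).IsChain R ∧ (a :: l).Nodup ∧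
      ∀ x, x ∈ a :: l ↔ ReflTransGen R a x := by
  induction hn : {x | ReflTransGen R a x}.ncard using Nat.strong_induction_on generalizing a with
  | _ n ih =>
  by_cases hstep : ∃ b, R a b
  · obtain ⟨b, hab⟩ := hstep
    have hba : ¬ ReflTransGen R b a := fun h => hacyclic a .refl (.head' hab h)
    have hlt : {x | ReflTransGen R b x}.ncard < n := hn ▸ Set.ncard_lt_ncard
      ⟨fun _ hx => .head hab hx, fun h => hba (h ReflTransGen.refl)⟩ (Set.toFinite _)
    obtain ⟨l, hchain, hnodup, hmem⟩ := ih _ hlt (fun c hc => hacyclic c (.head hab hc)) rfl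
    refine ⟨b :: l, hchain.cons_cons hab, List.nodup_cons.2 ⟨fun h => hba ((hmem a).1 h), hnodup⟩,
      fun x => ?_⟩
    rw [List.mem_cons, hmem, reflTransGen_iff_eq_or_of_rightUnique hR hab]
  · refine ⟨[], .singleton a, List.nodup_singleton a, fun x => ?_⟩
    rw [ReflTransGen.cases_head_iff, List.mem_singleton, eq_comm]
    exact (or_iff_left fun ⟨b, hab, _⟩ => hstep ⟨b, hab⟩).symm

end Relations

section AlternatingPaths

variable {α β : Type*}

/-- The left vertices that a relation between `α` and `β`, viewed as a set of edges of a bipartite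
graph, leaves unmatched. -/
def unmatched (M : α → β → Prop) : Set α := {x | ∀ y, ¬ M x y}

/-- One step of an alternating path between left vertices: along `M`, then back along `N`. -/
def alternatingStep (M N : α → β → Prop) (x x' : α) : Prop := ∃ y, M x y ∧ N x' y

/-- The exchange of two matchings: the relation that follows `N` on `S` and `M` outside `S`. -/
def switch (S : Set α) (M N : α → β → Prop) (x : α) (y : β) : Prop :=
  (x ∈ S ∧ N x y) ∨ (x ∉ S ∧ M x y)

/-- The relation `M` with the left vertex `p` made unmatched. -/
def unmatch (p : α) (M : α → β → Prop) (x : α) (y : β) : Prop := x ≠ p ∧ M x y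

/-- The left vertices of an augmenting path for `M` with respect to `N`, in their order: starting at
a vertex unmatched by `N`, they are all those reachable by alternating steps, and `M` matches each
of them. -/
structure IsAugmentingPath (M N : α → β → Prop) (a : α) (l : List α) : Prop where
  head_mem_unmatched : a ∈ unmatched N
  isChain : (a :: l).IsChain (alternatingStep M N)
  nodup : (a :: l).Nodup
  mem_iff : ∀ x, x ∈ a :: l ↔ ReflTransGen (alternatingStep M N) a x
  matched : ∀ x ∈ a :: l, x ∉ unmatched M

variable {M N : α → β → Prop} {S : Set α} {a : α} {l : List α}

theorem notMem_unmatched {x : α} : x ∉ unmatched M ↔ ∃ y, M x y := by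
  simp only [unmatched, Set.mem_ofPred_eq, not_forall, not_not]

theorem leftUnique_alternatingStep (hM : LeftUnique M) (hN : RightUnique N) :
    LeftUnique (alternatingStep M N) := by
  rintro x x' z ⟨y, hxy, hzy⟩ ⟨y', hxy', hzy'⟩
  exact hM hxy (hN hzy hzy' ▸ hxy')

theorem rightUnique_alternatingStep (hM : RightUnique M) (hN : LeftUnique N) :
    RightUnique (alternatingStep M N) := by
  rintro x z z' ⟨y, hxy, hzy⟩ ⟨y', hxy', hzy'⟩
  exact hN hzy (hM hxy hxy' ▸ hzy')

theorem not_alternatingStep_of_mem_unmatched {x a : α} (ha : a ∈ unmatched N) :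
    ¬ alternatingStep M N x a :=
  fun ⟨y, _, h⟩ => ha y h

theorem exists_isAugmentingPath [Finite α] (hM : BiUnique M) (hN : BiUnique N)
    (hlt : (unmatched M).ncard < (unmatched N).ncard) : ∃ a l, IsAugmentingPath M N a l := by
  have hleft := leftUnique_alternatingStep hM.1 hN.2
  have hsource : ∀ a ∈ unmatched N, ∀ x, ¬ alternatingStep M N x a :=
    fun _ ha _ => not_alternatingStep_of_mem_unmatched ha
  obtain ⟨a, ha, hmatched⟩ : ∃ a ∈ unmatched N,
      ∀ c, ReflTransGen (alternatingStep M N) a c → c ∉ unmatched M := by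
    by_contra! h
    choose! f hf hfM using h
    refine hlt.not_ge (Set.ncard_le_ncard_of_injOn f hfM (fun a ha b hb hab => ?_))
    exact source_eq_of_reflTransGen hleft (hsource a ha) (hsource b hb) (hf a ha) (hab ▸ hf b hb)
  obtain ⟨l, hchain, hnodup, hmem⟩ := exists_isChain_nodup_forall_mem_iff
    (rightUnique_alternatingStep hM.2 hN.1)
    fun _ => not_transGen_self_of_source hleft (hsource a ha)
  exact ⟨a, l, ha, hchain, hnodup, hmem, fun x hx => hmatched x ((hmem x).1 hx)⟩

namespace IsAugmentingPath

theorem mem_iff_mem_of_alternatingStep (h : IsAugmentingPath M N a l) (hM : LeftUnique M)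
    (hN : RightUnique N) {x x' : α} (hx : alternatingStep M N x x') :
    x ∈ a :: l ↔ x' ∈ a :: l := by
  rw [h.mem_iff, h.mem_iff]
  refine ⟨fun hax => hax.tail hx, fun hax' => ?_⟩
  rcases hax'.cases_tail with rfl | ⟨z, haz, hz⟩
  · exact absurd hx (not_alternatingStep_of_mem_unmatched h.head_mem_unmatched)
  · exact leftUnique_alternatingStep hM hN hx hz ▸ haz

theorem not_of_mem (h : IsAugmentingPath M N a l) (hM : LeftUnique M) (hN : RightUnique N)
    {x : α} (hx : x ∈ a :: l) {y : β} (hxy : M x y) : ¬ N x y := fun hxy' =>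
  not_transGen_self_of_source (leftUnique_alternatingStep hM hN)
    (fun _ => not_alternatingStep_of_mem_unmatched h.head_mem_unmatched) ((h.mem_iff x).1 hx)
    (.single ⟨y, hxy, hxy'⟩)

theorem mem_unmatched_right_iff (h : IsAugmentingPath M N a l) {x : α} (hx : x ∈ a :: l) :
    x ∈ unmatched N ↔ x = a :=
  ⟨fun hxN => (eq_of_reflTransGen_of_source
    (fun _ => not_alternatingStep_of_mem_unmatched hxN) ((h.mem_iff x).1 hx)).symm,
    fun hxa => hxa ▸ h.head_mem_unmatched⟩

end IsAugmentingPath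

theorem biUnique_switch (hM : BiUnique M) (hN : BiUnique N)
    (hS : ∀ x x', alternatingStep M N x x' → (x ∈ S ↔ x' ∈ S)) : BiUnique (switch S M N) := by
  constructor
  · rintro x x' y (⟨hx, hxy⟩ | ⟨hx, hxy⟩) (⟨hx', hxy'⟩ | ⟨hx', hxy'⟩)
    · exact hN.1 hxy hxy'
    · exact absurd ((hS x' x ⟨y, hxy', hxy⟩).2 hx) hx'
    · exact absurd ((hS x x' ⟨y, hxy, hxy'⟩).2 hx') hx
    · exact hM.1 hxy hxy'
  · rintro x y y' (⟨hx, hxy⟩ | ⟨hx, hxy⟩) (⟨hx', hxy'⟩ | ⟨hx', hxy'⟩)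
    exacts [hN.2 hxy hxy', absurd hx hx', absurd hx' hx, hM.2 hxy hxy']

theorem unmatched_switch (S : Set α) (M N : α → β → Prop) :
    unmatched (switch S M N) = S.ite (unmatched N) (unmatched M) := by
  ext x
  by_cases hx : x ∈ S <;> simp [unmatched, switch, Set.ite, hx]

theorem ncard_ite_add_ncard_ite [Finite α] (S A B : Set α) :
    (S.ite A B).ncard + (S.ite B A).ncard = A.ncard + B.ncard := by
  have hite : ∀ A B : Set α, (S.ite A B).ncard = (A ∩ S).ncard + (B \ S).ncard := fun A B =>
    Set.ncard_union_eq (Set.disjoint_sdiff_right.mono_left Set.inter_subset_right)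
  rw [hite, hite, ← Set.ncard_inter_add_ncard_sdiff_eq_ncard A S,
    ← Set.ncard_inter_add_ncard_sdiff_eq_ncard B S]
  ring

theorem IsAugmentingPath.unmatched_switch_eq_insert (h : IsAugmentingPath M N a l) :
    unmatched (switch {x | x ∈ a :: l} M N) = insert a (unmatched M) := by
  ext x
  rw [unmatched_switch]
  have := h.mem_unmatched_right_iff (x := x)
  have := h.matched x
  simp only [Set.ite, Set.mem_union, Set.mem_inter_iff, Set.mem_sdiff, Set.mem_ofPred_eq,
    Set.mem_insert_iff]
  grind

theorem switch_singleton (ha : a ∈ unmatched N) : switch {a} M N = unmatch a M := by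
  ext x y
  have := ha y
  simp only [switch, unmatch, Set.mem_singleton_iff]
  grind

theorem unmatch_switch_singleton (ha : a ∈ unmatched N) : unmatch a (switch {a} N M) = N := by
  ext x y
  have := ha y
  simp only [switch, unmatch, Set.mem_singleton_iff]
  grind

end AlternatingPaths

theorem exists_isTrail_mem_edges_iff {V : Type*} {G : SimpleGraph V} {x y v : V}
    (hxy : x = y ∨ G.Adj x y) (w : G.Walk y v) (hw : w.IsTrail)
    (hnew : G.Adj x y → s(x, y) ∉ w.edges) :
    ∃ w' : G.Walk x v, w'.IsTrail ∧
      ∀ e, ¬ e.IsDiag → (e ∈ w'.edges ↔ e = s(x, y) ∨ e ∈ w.edges) := by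
  rcases hxy with rfl | hadj
  · refine ⟨w, hw, fun e he => (or_iff_right ?_).symm⟩
    rintro rfl
    exact he rfl
  · refine ⟨.cons hadj w, (SimpleGraph.Walk.isTrail_cons _ _).2 ⟨hw, hnew hadj⟩, fun e _ => ?_⟩
    rw [SimpleGraph.Walk.edges_cons, List.mem_cons]

section Matching

variable {P : Type*}

/-- The points related to themselves. -/
def loops (M : P → P → Prop) : Set P := {x | M x x}

theorem loops_switch (S : Set P) (M N : P → P → Prop) :
    loops (switch S M N) = S.ite (loops N) (loops M) := by
  ext x
  simp [loops, switch, Set.ite, and_comm]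

variable [PartialOrder P]

/-- A matching of the bipartite graph of `≥` on two copies of `P`: the first argument is the upper
point of an edge, the second one the lower point. -/
structure IsMatching (M : P → P → Prop) : Prop where
  le : ∀ ⦃x y⦄, M x y → y ≤ x
  biUnique : BiUnique M

/-- A matching with `k` unmatched upper points and the least possible number of loops. -/
structure IsOptimalMatching (k : ℕ) (M : P → P → Prop) : Prop where
  isMatching : IsMatching M
  ncard_unmatched : (unmatched M).ncard = k
  ncard_loops_le : ∀ N : P → P → Prop, IsMatching N → (unmatched N).ncard = k →
    (loops M).ncard ≤ (loops N).ncard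

/-- The non-loop part of a matching. -/
def strictPart (M : P → P → Prop) (x y : P) : Prop := M x y ∧ y < x

/-- The edges of the comparability graph underlying the non-loop part of a matching. -/
def strictEdges (M : P → P → Prop) : Set (Sym2 P) := {e | ∃ x y, strictPart M x y ∧ e = s(x, y)}

/-- The counterpart for matchings of the two ways in which the theorem enlarges a chain family:
`M'` differs from `M` by a trail of the comparability graph, or it arises from `M` by deleting a
loop. -/
def IsAugmentation (M M' : P → P → Prop) : Prop :=
  (∃ (u v : P) (w : (comparabilityGraph P).Walk u v), w.IsTrail ∧ 0 < w.length ∧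
    strictEdges M' = symmDiff (strictEdges M) {e | e ∈ w.edges}) ∨
  ∃ p ∈ loops M, M' = unmatch p M

variable {M N : P → P → Prop} {S : Set P} {a : P} {l : List P} {k : ℕ}

theorem mk_eq_mk_iff_of_lt_of_le {x y x' y' : P} (h : y < x) (h' : y' ≤ x') :
    s(x, y) = s(x', y') ↔ x = x' ∧ y = y' := by
  rw [Sym2.eq_iff, or_iff_left]
  rintro ⟨rfl, rfl⟩
  exact h.not_ge h'

theorem IsMatching.eq_and_eq_iff (hM : IsMatching M) {a y p q : P} (hay : M a y) :
    p = a ∧ q = y ↔ p = a ∧ M p q := by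
  refine and_congr_right ?_
  rintro rfl
  exact ⟨fun h => h ▸ hay, fun h => hM.biUnique.2 h hay⟩

theorem mk_mem_strictEdges_iff {x y : P} (h : y < x) : s(x, y) ∈ strictEdges M ↔ M x y := by
  refine ⟨?_, fun hxy => ⟨x, y, ⟨hxy, h⟩, rfl⟩⟩
  rintro ⟨x', y', ⟨hxy, h'⟩, e⟩
  obtain ⟨rfl, rfl⟩ := (mk_eq_mk_iff_of_lt_of_le h h'.le).1 e
  exact hxy

theorem strictEdges_subset_edgeSet (M : P → P → Prop) :
    strictEdges M ⊆ (comparabilityGraph P).edgeSet := by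
  rintro _ ⟨x, y, h, rfl⟩
  exact .inr h.2

theorem eq_of_forall_mk_mem_iff {E F : Set (Sym2 P)} (hE : E ⊆ (comparabilityGraph P).edgeSet)
    (hF : F ⊆ (comparabilityGraph P).edgeSet)
    (h : ∀ x y, y < x → (s(x, y) ∈ E ↔ s(x, y) ∈ F)) : E = F := by
  ext e
  induction e with | _ x y
  by_cases hadj : (comparabilityGraph P).Adj x y
  · rcases hadj with hxy | hyx
    · rw [Sym2.eq_swap]
      exact h y x hxy
    · exact h x y hyx
  · exact iff_of_false (fun he => hadj (hE he)) fun he => hadj (hF he)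

theorem strictEdges_switch {E : Set (Sym2 P)} (hE : E ⊆ (comparabilityGraph P).edgeSet)
    (hmem : ∀ ⦃x y⦄, y < x → (s(x, y) ∈ E ↔ x ∈ S ∧ (M x y ∨ N x y)))
    (hdisj : ∀ x ∈ S, ∀ y, M x y → ¬ N x y) :
    strictEdges (switch S M N) = symmDiff (strictEdges M) E := by
  refine eq_of_forall_mk_mem_iff (strictEdges_subset_edgeSet _)
    (Set.symmDiff_subset_union.trans (Set.union_subset (strictEdges_subset_edgeSet _) hE))
    fun x y h => ?_
  rw [Set.mem_symmDiff, mk_mem_strictEdges_iff h, mk_mem_strictEdges_iff h, hmem h]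
  have := hdisj x
  simp only [switch]
  grind

theorem IsMatching.exists_isTrail_cons (hM : IsMatching M) {p q x y v : P} (hpq : M p q)
    (hxy : s(x, y) = s(p, q)) (w : (comparabilityGraph P).Walk y v) (hw : w.IsTrail)
    (hnew : q < p → s(p, q) ∉ w.edges) :
    ∃ w' : (comparabilityGraph P).Walk x v, w'.IsTrail ∧ ∀ ⦃p' q'⦄, q' < p' →
      (s(p', q') ∈ w'.edges ↔ (p' = p ∧ M p' q') ∨ s(p', q') ∈ w.edges) := by
  have hqp := hM.le hpq
  have hadj : x = y ∨ (comparabilityGraph P).Adj x y := by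
    rcases Sym2.eq_iff.1 hxy with ⟨rfl, rfl⟩ | ⟨rfl, rfl⟩
    exacts [hqp.eq_or_lt.imp Eq.symm .inr, hqp.eq_or_lt.imp id .inl]
  obtain ⟨w', hw', hedges⟩ := exists_isTrail_mem_edges_iff hadj w hw fun hadj =>
    hxy ▸ hnew (hqp.lt_of_ne fun h => hadj.ne (by grind [Sym2.eq_iff]))
  refine ⟨w', hw', fun p' q' hlt => ?_⟩
  rw [hedges _ (by simpa using hlt.ne'), hxy, mk_eq_mk_iff_of_lt_of_le hlt hqp,
    hM.eq_and_eq_iff hpq]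

theorem exists_isTrail_of_isChain (hM : IsMatching M) (hN : IsMatching N)
    (hchain : (a :: l).IsChain (alternatingStep M N)) (hnodup : (a :: l).Nodup)
    (hmatched : ∀ x ∈ a :: l, x ∉ unmatched M) :
    ∃ (v : P) (w : (comparabilityGraph P).Walk a v), w.IsTrail ∧ ∀ ⦃x y⦄, y < x →
      (s(x, y) ∈ w.edges ↔ (x ∈ a :: l ∧ M x y) ∨ (x ∈ l ∧ N x y)) := by
  induction l generalizing a with
  | nil =>
    obtain ⟨y, hay⟩ := notMem_unmatched.1 (hmatched a List.mem_cons_self)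
    obtain ⟨w, hw, hedges⟩ := hM.exists_isTrail_cons hay rfl .nil .nil (fun _ => by simp)
    refine ⟨y, w, hw, fun p q hqp => ?_⟩
    rw [hedges hqp]
    simp
  | cons b l ih =>
    obtain ⟨⟨y, hay, hby⟩, hchain⟩ := List.isChain_cons_cons.1 hchain
    obtain ⟨ha, hnodup⟩ := List.nodup_cons.1 hnodup
    have hb : b ∉ l := (List.nodup_cons.1 hnodup).1
    have hab : a ≠ b := fun h => ha (h ▸ List.mem_cons_self)
    obtain ⟨v, w, hw, hedges⟩ := ih hchain hnodup fun x hx => hmatched x (.tail a hx)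
    obtain ⟨w₁, hw₁, hedges₁⟩ := hN.exists_isTrail_cons hby Sym2.eq_swap w hw fun hlt h =>
      ((hedges hlt).1 h).elim (fun h => hab (hM.biUnique.1 hay h.2)) fun h => hb h.1
    obtain ⟨w₂, hw₂, hedges₂⟩ := hM.exists_isTrail_cons hay rfl w₁ hw₁ fun hlt h =>
      ((hedges₁ hlt).1 h).elim (fun h => hab h.1) fun h =>
        ((hedges hlt).1 h).elim (fun h => ha h.1) fun h => ha (.tail b h.1)
    refine ⟨v, w₂, hw₂, fun p q hqp => ?_⟩
    rw [hedges₂ hqp, hedges₁ hqp, hedges hqp]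
    grind

theorem IsAugmentingPath.exists_isTrail (h : IsAugmentingPath M N a l) (hM : IsMatching M)
    (hN : IsMatching N) :
    ∃ (v : P) (w : (comparabilityGraph P).Walk a v), w.IsTrail ∧ ∀ ⦃x y⦄, y < x →
      (s(x, y) ∈ w.edges ↔ x ∈ a :: l ∧ (M x y ∨ N x y)) := by
  obtain ⟨v, w, hw, hedges⟩ := exists_isTrail_of_isChain hM hN h.isChain h.nodup h.matched
  refine ⟨v, w, hw, fun x y hlt => ?_⟩
  have haN : ¬ N a y := h.head_mem_unmatched y
  rw [hedges hlt]
  grind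

theorem IsAugmentingPath.eq_nil_of_forall_lt (h : IsAugmentingPath M N a l) (hM : IsMatching M)
    (hN : IsMatching N) (hnone : ∀ x ∈ a :: l, ∀ y < x, ¬ (M x y ∨ N x y)) :
    l = [] ∧ a ∈ loops M := by
  have heq : ∀ x ∈ a :: l, ∀ y, M x y ∨ N x y → y = x := fun x hx y hxy =>
    eq_of_le_of_not_lt (hxy.elim (@hM.le x y) (@hN.le x y)) fun hlt => hnone x hx y hlt hxy
  have hMa : M a a := by
    obtain ⟨y, hay⟩ := notMem_unmatched.1 (h.matched a List.mem_cons_self)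
    exact heq a List.mem_cons_self y (.inl hay) ▸ hay
  refine ⟨?_, hMa⟩
  rcases l with _ | ⟨b, l⟩
  · rfl
  · obtain ⟨y, hay, hby⟩ := (List.isChain_cons_cons.1 h.isChain).1
    have hya := hM.biUnique.2 hay hMa
    have hyb := heq b (by simp) y (.inr hby)
    exact absurd (hya.symm.trans hyb) fun hab =>
      (List.nodup_cons.1 h.nodup).1 (hab ▸ List.mem_cons_self)

theorem IsAugmentingPath.isAugmentation (h : IsAugmentingPath M N a l) (hM : IsMatching M)
    (hN : IsMatching N) :
    IsAugmentation M (switch {x | x ∈ a :: l} M N) ∧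
      IsAugmentation (switch {x | x ∈ a :: l} N M) N := by
  obtain ⟨v, w, hw, hedges⟩ := h.exists_isTrail hM hN
  rcases Nat.eq_zero_or_pos w.length with hzero | hpos
  · have hnil : w.edges = [] := List.length_eq_zero_iff.1 (w.length_edges.trans hzero)
    obtain ⟨rfl, ha⟩ := h.eq_nil_of_forall_lt hM hN fun x hx y hlt hxy => by
      simpa [hnil] using (hedges hlt).2 ⟨hx, hxy⟩
    have hS : {x | x ∈ [a]} = {a} := by simp
    rw [hS]
    exact ⟨.inr ⟨a, ha, switch_singleton h.head_mem_unmatched⟩,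
      .inr ⟨a, .inl ⟨rfl, ha⟩, (unmatch_switch_singleton h.head_mem_unmatched).symm⟩⟩
  · have hdisj : ∀ x ∈ a :: l, ∀ y, M x y → ¬ N x y := fun _ hx _ =>
      h.not_of_mem hM.biUnique.1 hN.biUnique.2 hx
    have hM' := strictEdges_switch (S := {x | x ∈ a :: l})
      (E := {e | e ∈ w.edges}) w.edges_subset_edgeSet hedges hdisj
    have hN' := strictEdges_switch (S := {x | x ∈ a :: l}) (M := N) (N := M)
      (E := {e | e ∈ w.edges}) w.edges_subset_edgeSet
      (fun x y hlt => by rw [or_comm]; exact hedges hlt)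
      fun x hx y hN hM => hdisj x hx y hM hN
    refine ⟨.inl ⟨a, v, w, hw, hpos, hM'⟩, .inl ⟨a, v, w, hw, hpos, ?_⟩⟩
    rw [hN', symmDiff_symmDiff_cancel_right]

theorem IsMatching.switch (hM : IsMatching M) (hN : IsMatching N)
    (hS : ∀ x x', alternatingStep M N x x' → (x ∈ S ↔ x' ∈ S)) : IsMatching (switch S M N) where
  le := by
    rintro x y (⟨-, h⟩ | ⟨-, h⟩)
    exacts [hN.le h, hM.le h]
  biUnique := biUnique_switch hM.biUnique hN.biUnique hS

/-- Both switches have the sizes of the original matchings, interchanged, and their numbers of loops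
have the same sum; hence neither can have more loops than the optimum for its size. -/
theorem IsOptimalMatching.switch [Finite P] (hM : IsOptimalMatching k M)
    (hN : IsOptimalMatching (k + 1) N)
    (hS : ∀ x x', alternatingStep M N x x' → (x ∈ S ↔ x' ∈ S))
    (hcard : (unmatched (switch S M N)).ncard = k + 1) :
    IsOptimalMatching (k + 1) (switch S M N) ∧ IsOptimalMatching k (switch S N M) := by
  have hM' := hM.isMatching.switch hN.isMatching hS
  have hN' := hN.isMatching.switch hM.isMatching
    fun x x' ⟨y, hxy, hxy'⟩ => (hS x' x ⟨y, hxy', hxy⟩).symm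
  have hunmatched := ncard_ite_add_ncard_ite S (unmatched N) (unmatched M)
  rw [← unmatched_switch, ← unmatched_switch, hcard, hN.ncard_unmatched, hM.ncard_unmatched,
    Nat.add_right_inj] at hunmatched
  have hloops := ncard_ite_add_ncard_ite S (loops N) (loops M)
  rw [← loops_switch, ← loops_switch] at hloops
  have hleM := hM.ncard_loops_le _ hN' hunmatched
  have hleN := hN.ncard_loops_le _ hM' hcard
  exact ⟨⟨hM', hcard, fun L hL hk => by have := hN.ncard_loops_le L hL hk; lia⟩,
    ⟨hN', hunmatched, fun L hL hk => by have := hM.ncard_loops_le L hL hk; lia⟩⟩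

theorem exists_isOptimalMatching_isAugmentation [Finite P] (hM : IsOptimalMatching k M)
    (hN : IsOptimalMatching (k + 1) N) :
    ∃ M' N' : P → P → Prop, IsOptimalMatching (k + 1) M' ∧ IsOptimalMatching k N' ∧
      IsAugmentation M M' ∧ IsAugmentation N' N := by
  have hM₀ := hM.isMatching
  have hN₀ := hN.isMatching
  obtain ⟨a, l, h⟩ := exists_isAugmentingPath hM₀.biUnique hN₀.biUnique
    (by rw [hM.ncard_unmatched, hN.ncard_unmatched]; exact k.lt_succ_self)
  have hcard : (unmatched (switch {x | x ∈ a :: l} M N)).ncard = k + 1 := by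
    rw [h.unmatched_switch_eq_insert,
      Set.ncard_insert_of_notMem (h.matched a List.mem_cons_self), hM.ncard_unmatched]
  obtain ⟨hM', hN'⟩ := hM.switch hN
    (fun _ _ => h.mem_iff_mem_of_alternatingStep hM₀.biUnique.1 hN₀.biUnique.2) hcard
  obtain ⟨haugM, haugN⟩ := h.isAugmentation hM₀ hN₀
  exact ⟨_, _, hM', hN', haugM, haugN⟩

end Matching

section ChainFamily

variable {P : Type*} [PartialOrder P]

/-- The matching that encodes a chain family: the covering relations of its chains, and a loop at
each point that the family misses. -/
def chainMatching (C : Set (Set P)) (x y : P) : Prop :=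
  (∃ A ∈ C, CoversIn A x y) ∨ (x = y ∧ x ∉ ⋃₀ C)

/-- The chain of the points from which the non-loop part of `M` descends to `b`. -/
def chainAbove (M : P → P → Prop) (b : P) : Set P := {x | ReflTransGen (strictPart M) x b}

/-- The chain family encoded by a matching. -/
def chainFamily (M : P → P → Prop) : Set (Set P) := chainAbove M '' unmatched M

/-- The counterpart of `IsAugmentation` for chain families: the two ways in which the theorem
enlarges a chain family. -/
def IsFamilyAugmentation (C C' : Set (Set P)) : Prop :=
  DiffersByPath C C' ∨ ∃ p, p ∉ ⋃₀ C ∧ C' = insert {p} C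

variable {C D : Set (Set P)} {A B : Set P} {M : P → P → Prop} {b c p x y z : P} {k m : ℕ}

theorem exists_coversIn [WellFoundedGT P] (hx : x ∈ A) (hz : z ∈ A) (h : z < x) :
    ∃ y, CoversIn A x y := by
  obtain ⟨y, hy⟩ := exists_maximal_of_wellFoundedGT (fun y => y ∈ A ∧ y < x) ⟨z, hz, h⟩
  exact ⟨y, hx, hy.prop.1, hy.prop.2, fun w hw hyw => hyw.1.not_ge (hy.2 ⟨hw, hyw.2⟩ hyw.1.le)⟩

theorem rightUnique_coversIn (hA : IsChain (· ≤ ·) A) : RightUnique (CoversIn A) := by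
  rintro x y z ⟨-, hy, hyx, hnoy⟩ ⟨-, hz, hzx, hnoz⟩
  by_contra hne
  rcases hA.total hy hz with h | h
  · exact hnoy z hz ⟨h.lt_of_ne hne, hzx⟩
  · exact hnoz y hy ⟨h.lt_of_ne' hne, hyx⟩

theorem leftUnique_coversIn (hA : IsChain (· ≤ ·) A) : LeftUnique (CoversIn A) := by
  rintro x y z ⟨hx, -, hzx, hnox⟩ ⟨hy, -, hzy, hnoy⟩
  by_contra hne
  rcases hA.total hx hy with h | h
  · exact hnoy x hx ⟨hzx, h.lt_of_ne hne⟩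
  · exact hnox y hy ⟨hzy, h.lt_of_ne' hne⟩

theorem IsChainFamily.eq_of_mem (hC : IsChainFamily k C) (hA : A ∈ C) (hB : B ∈ C) (hxA : x ∈ A)
    (hxB : x ∈ B) : A = B := by
  by_contra h
  exact Set.disjoint_left.1 (hC.disjoint A hA B hB h) hxA hxB

theorem IsChainFamily.isMatching (hC : IsChainFamily k C) : IsMatching (chainMatching C) where
  le := by
    rintro x y (⟨A, -, -, -, h, -⟩ | ⟨rfl, -⟩)
    exacts [h.le, le_rfl]
  biUnique := by
    constructor
    · rintro x y z (⟨A, hA, h⟩ | ⟨rfl, h⟩) (⟨B, hB, h'⟩ | ⟨rfl, h'⟩)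
      · obtain rfl := hC.eq_of_mem hA hB h.2.1 h'.2.1
        exact leftUnique_coversIn (hC.isChain A hA) h h'
      · exact absurd ⟨A, hA, h.2.1⟩ h'
      · exact absurd ⟨B, hB, h'.2.1⟩ h
      · rfl
    · rintro x y z (⟨A, hA, h⟩ | ⟨rfl, h⟩) (⟨B, hB, h'⟩ | ⟨rfl, h'⟩)
      · obtain rfl := hC.eq_of_mem hA hB h.1 h'.1
        exact rightUnique_coversIn (hC.isChain A hA) h h'
      · exact absurd ⟨A, hA, h.1⟩ h'
      · exact absurd ⟨B, hB, h'.1⟩ h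
      · rfl

theorem loops_chainMatching (C : Set (Set P)) : loops (chainMatching C) = (⋃₀ C)ᶜ := by
  ext x
  simp only [loops, chainMatching, Set.mem_ofPred_eq, Set.mem_compl_iff, true_and]
  exact or_iff_right fun ⟨A, _, h⟩ => lt_irrefl _ h.2.2.1

theorem strictPart_chainMatching :
    strictPart (chainMatching C) x y ↔ ∃ A ∈ C, CoversIn A x y := by
  refine ⟨fun ⟨h, hlt⟩ => h.resolve_right fun h => hlt.ne' h.1, fun h => ⟨.inl h, ?_⟩⟩
  obtain ⟨A, -, hA⟩ := h
  exact hA.2.2.1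

theorem strictEdges_chainMatching (C : Set (Set P)) :
    strictEdges (chainMatching C) = chainEdges C := by
  ext e
  simp only [strictEdges, chainEdges, strictPart_chainMatching, Set.mem_ofPred_eq]
  exact ⟨fun ⟨x, y, ⟨A, hA, h⟩, he⟩ => ⟨A, hA, x, y, h, he⟩,
    fun ⟨A, hA, x, y, h, he⟩ => ⟨x, y, ⟨A, hA, h⟩, he⟩⟩

theorem le_of_reflTransGen_strictPart (h : ReflTransGen (strictPart M) x y) : y ≤ x := by
  induction h with
  | refl => exact le_rfl
  | tail _ h ih => exact h.2.le.trans ih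

theorem IsMatching.biUnique_strictPart (hM : IsMatching M) : BiUnique (strictPart M) :=
  ⟨fun _ _ _ h h' => hM.biUnique.1 h.1 h'.1, fun _ _ _ h h' => hM.biUnique.2 h.1 h'.1⟩

theorem IsMatching.strictPart_iff (hM : IsMatching M) : strictPart M x y ↔ M x y ∧ x ≠ y :=
  and_congr_right fun h => ⟨ne_of_gt, fun hne => (hM.le h).lt_of_ne' hne⟩

theorem IsMatching.reflTransGen_strictPart_iff_le (hM : IsMatching M) (hx : x ∈ chainAbove M b)
    (hy : y ∈ chainAbove M b) : ReflTransGen (strictPart M) x y ↔ y ≤ x := by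
  refine ⟨le_of_reflTransGen_strictPart, fun hyx => ?_⟩
  rcases reflTransGen_total_of_leftUnique hM.biUnique_strictPart.1 hx hy with h | h
  · exact h
  · exact hyx.antisymm (le_of_reflTransGen_strictPart h) ▸ .refl

theorem IsMatching.isChain_chainAbove (hM : IsMatching M) (b : P) :
    IsChain (· ≤ ·) (chainAbove M b) := fun _ hx _ hy _ =>
  (reflTransGen_total_of_leftUnique hM.biUnique_strictPart.1 hx hy).symm.imp
    le_of_reflTransGen_strictPart le_of_reflTransGen_strictPart

theorem IsMatching.eq_of_mem_chainAbove (hM : IsMatching M) (hb : b ∈ unmatched M)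
    (hc : c ∈ unmatched M) (hxb : x ∈ chainAbove M b) (hxc : x ∈ chainAbove M c) : b = c := by
  have hsink : ∀ {b c}, b ∈ unmatched M → ReflTransGen (strictPart M) b c → b = c :=
    fun hb h => h.cases_head.elim id fun ⟨y, hy, _⟩ => absurd hy.1 (hb y)
  exact (ReflTransGen.total_of_right_unique hM.biUnique_strictPart.2 hxb hxc).elim (hsink hb)
    fun h => (hsink hc h).symm

theorem IsMatching.coversIn_chainAbove (hM : IsMatching M) :
    CoversIn (chainAbove M b) x y ↔ strictPart M x y ∧ y ∈ chainAbove M b := by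
  constructor
  · rintro ⟨hx, hy, hlt, hno⟩
    refine ⟨?_, hy⟩
    obtain rfl | ⟨z, hxz, hzy⟩ := ((hM.reflTransGen_strictPart_iff_le hx hy).2 hlt.le).cases_head
    · exact absurd hlt (lt_irrefl _)
    · have hyz : ¬ y < z := fun h => hno z (hzy.trans hy) ⟨h, hxz.2⟩
      exact (le_of_reflTransGen_strictPart hzy).eq_of_not_lt hyz ▸ hxz
  · rintro ⟨hxy, hy⟩
    have hx : x ∈ chainAbove M b := hy.head hxy
    refine ⟨hx, hy, hxy.2, fun z hz ⟨hyz, hzx⟩ => ?_⟩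
    have hxz := (hM.reflTransGen_strictPart_iff_le hx hz).2 hzx.le
    rcases (reflTransGen_iff_eq_or_of_rightUnique hM.biUnique_strictPart.2 hxy).1 hxz with rfl | h
    · exact lt_irrefl _ hzx
    · exact hyz.not_ge (le_of_reflTransGen_strictPart h)

theorem IsMatching.exists_mem_chainAbove [WellFoundedLT P] (hM : IsMatching M) (hx : x ∉ loops M) :
    ∃ b ∈ unmatched M, x ∈ chainAbove M b := by
  induction x using WellFoundedLT.induction with
  | _ x ih =>
  by_cases hb : x ∈ unmatched M
  · exact ⟨x, hb, .refl⟩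
  · obtain ⟨y, hxy⟩ := notMem_unmatched.1 hb
    have hlt : y < x := (hM.le hxy).lt_of_ne fun h => hx (h ▸ hxy : M x x)
    obtain ⟨b, hb, hyb⟩ := ih y hlt fun hy => hlt.ne' (hM.biUnique.1 hxy hy)
    exact ⟨b, hb, hyb.head ⟨hxy, hlt⟩⟩

theorem IsMatching.notMem_loops_of_mem_chainAbove (hM : IsMatching M) (hb : b ∈ unmatched M)
    (hx : x ∈ chainAbove M b) : x ∉ loops M := fun hxx => by
  rcases hx.cases_head with rfl | ⟨y, hxy, -⟩
  · exact hb _ hxx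
  · exact hxy.2.ne (hM.biUnique.2 hxy.1 hxx)

theorem IsMatching.sUnion_chainFamily [WellFoundedLT P] (hM : IsMatching M) :
    ⋃₀ chainFamily M = (loops M)ᶜ := by
  ext x
  simp only [chainFamily, Set.sUnion_image, Set.mem_iUnion, exists_prop, Set.mem_compl_iff]
  exact ⟨fun ⟨b, hb, hx⟩ => hM.notMem_loops_of_mem_chainAbove hb hx, hM.exists_mem_chainAbove⟩

theorem IsMatching.chainMatching_chainFamily [WellFoundedLT P] (hM : IsMatching M) :
    chainMatching (chainFamily M) = M := by
  have hcovers : ∀ x y, (∃ A ∈ chainFamily M, CoversIn A x y) ↔ strictPart M x y := fun x y => by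
    simp only [chainFamily, Set.exists_mem_image, hM.coversIn_chainAbove]
    refine ⟨fun ⟨_, _, h, _⟩ => h, fun h => ?_⟩
    obtain ⟨b, hb, hy⟩ := hM.exists_mem_chainAbove fun hy => h.2.ne' (hM.biUnique.1 h.1 hy)
    exact ⟨b, hb, h, hy⟩
  ext x y
  rw [chainMatching, hcovers, hM.sUnion_chainFamily, Set.notMem_compl_iff, hM.strictPart_iff]
  by_cases hxy : x = y
  · subst hxy
    simp [loops]
  · simp [hxy]

theorem IsMatching.isChainFamily_chainFamily [Finite P] (hM : IsMatching M) :
    IsChainFamily (unmatched M).ncard (chainFamily M) where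
  finite := Set.toFinite _
  nonempty := by
    rintro _ ⟨b, -, rfl⟩
    exact ⟨b, ReflTransGen.refl⟩
  isChain := by
    rintro _ ⟨b, -, rfl⟩
    exact hM.isChain_chainAbove b
  disjoint := by
    rintro _ ⟨b, hb, rfl⟩ _ ⟨c, hc, rfl⟩ hne
    exact Set.disjoint_left.2 fun x hx hx' =>
      hne (congrArg _ (hM.eq_of_mem_chainAbove hb hc hx hx'))
  ncard_eq := Set.InjOn.ncard_image fun b hb c hc h =>
    hM.eq_of_mem_chainAbove hb hc .refl (h ▸ ReflTransGen.refl : b ∈ chainAbove M c)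

theorem IsChainFamily.chainAbove_chainMatching [WellFoundedLT P] [WellFoundedGT P]
    (hC : IsChainFamily k C) (hA : A ∈ C) (hbA : b ∈ A) (hb : b ∈ unmatched (chainMatching C)) :
    chainAbove (chainMatching C) b = A := by
  have hle : ∀ x ∈ A, b ≤ x := fun x hx => by
    by_contra hbx
    have hxb := ((hC.isChain A hA).total hbA hx).resolve_left hbx
    obtain ⟨y, hy⟩ := exists_coversIn hbA hx (hxb.lt_of_not_ge hbx)
    exact hb y (.inl ⟨A, hA, hy⟩)
  refine Set.Subset.antisymm (fun x hx => ?_) fun x hx => ?_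
  · induction hx using ReflTransGen.head_induction_on with
    | refl => exact hbA
    | head h _ hc =>
      obtain ⟨B, hB, h⟩ := strictPart_chainMatching.1 h
      exact hC.eq_of_mem hB hA h.2.1 hc ▸ h.1
  · induction x using WellFoundedLT.induction with
    | _ x ih =>
    rcases (hle x hx).eq_or_lt with rfl | hlt
    · exact .refl
    · obtain ⟨y, hy⟩ := exists_coversIn hx hbA hlt
      exact (ih y hy.2.2.1 hy.2.1).head (strictPart_chainMatching.2 ⟨A, hA, hy⟩)

theorem IsChainFamily.exists_mem_unmatched_chainMatching [WellFoundedLT P]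
    (hC : IsChainFamily k C) (hA : A ∈ C) : ∃ b ∈ A, b ∈ unmatched (chainMatching C) := by
  obtain ⟨b, hb⟩ := exists_minimal_of_wellFoundedLT (· ∈ A) (hC.nonempty A hA)
  refine ⟨b, hb.prop, ?_⟩
  rintro y (⟨B, hB, h⟩ | ⟨-, h⟩)
  · exact hb.not_lt (hC.eq_of_mem hB hA h.1 hb.prop ▸ h.2.1) h.2.2.1
  · exact h ⟨A, hA, hb.prop⟩

theorem IsChainFamily.chainFamily_chainMatching [WellFoundedLT P] [WellFoundedGT P]
    (hC : IsChainFamily k C) : chainFamily (chainMatching C) = C := by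
  refine Set.Subset.antisymm ?_ fun A hA => ?_
  · rintro _ ⟨b, hb, rfl⟩
    obtain ⟨A, hA, hbA⟩ : b ∈ ⋃₀ C := by
      by_contra h
      exact hb b (.inr ⟨rfl, h⟩)
    rwa [hC.chainAbove_chainMatching hA hbA hb]
  · obtain ⟨b, hbA, hb⟩ := hC.exists_mem_unmatched_chainMatching hA
    exact ⟨b, hb, hC.chainAbove_chainMatching hA hbA hb⟩

theorem IsChainFamily.ncard_unmatched_chainMatching [Finite P] (hC : IsChainFamily k C) :
    (unmatched (chainMatching C)).ncard = k := by
  rw [← hC.isMatching.isChainFamily_chainFamily.ncard_eq, hC.chainFamily_chainMatching,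
    hC.ncard_eq]

theorem IsChainFamily.isMaximalChainFamily_iff [Finite P] (hC : IsChainFamily k C) :
    IsMaximalChainFamily k C ↔ IsOptimalMatching k (chainMatching C) := by
  have hloops : ∀ D : Set (Set P), (loops (chainMatching C)).ncard ≤
      (loops (chainMatching D)).ncard ↔ (⋃₀ D).ncard ≤ (⋃₀ C).ncard := fun D => by
    have hsumC := Set.ncard_add_ncard_compl (⋃₀ C)
    have hsumD := Set.ncard_add_ncard_compl (⋃₀ D)
    rw [loops_chainMatching, loops_chainMatching]
    lia
  refine ⟨fun h => ⟨hC.isMatching, hC.ncard_unmatched_chainMatching, ?_⟩,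
    fun h => ⟨hC, fun D hD => (hloops D).1
      (h.ncard_loops_le _ hD.isMatching hD.ncard_unmatched_chainMatching)⟩⟩
  rintro N hN rfl
  rw [← hN.chainMatching_chainFamily]
  exact (hloops _).2 (h.2 _ hN.isChainFamily_chainFamily)

theorem IsOptimalMatching.exists_isMaximalChainFamily [Finite P] (hM : IsOptimalMatching k M) :
    ∃ C, IsMaximalChainFamily k C ∧ chainMatching C = M := by
  have hC := hM.ncard_unmatched ▸ hM.isMatching.isChainFamily_chainFamily
  have heq := hM.isMatching.chainMatching_chainFamily
  exact ⟨_, hC.isMaximalChainFamily_iff.2 (heq.symm ▸ hM), heq⟩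

theorem IsChainFamily.exists_isMaximalChainFamily [Finite P] (hC : IsChainFamily k C) :
    ∃ D : Set (Set P), IsMaximalChainFamily k D := by
  obtain ⟨D, hD, hmax⟩ := Set.exists_max_image {D : Set (Set P) | IsChainFamily k D}
    (fun D => (⋃₀ D).ncard) (Set.toFinite _) ⟨C, hC⟩
  exact ⟨D, hD, hmax⟩

theorem IsChainFamily.insert_singleton (hC : IsChainFamily k C) (hp : p ∉ ⋃₀ C) :
    IsChainFamily (k + 1) (insert {p} C) where
  finite := hC.finite.insert _
  nonempty := by
    rintro A (rfl | hA)
    exacts [Set.singleton_nonempty p, hC.nonempty A hA]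
  isChain := by
    rintro A (rfl | hA)
    exacts [Set.pairwise_singleton _ _, hC.isChain A hA]
  disjoint := by
    have h : ∀ A ∈ C, Disjoint {p} A := fun A hA =>
      Set.disjoint_singleton_left.2 fun hpA => hp ⟨A, hA, hpA⟩
    rintro A (rfl | hA) B (rfl | hB) hne
    exacts [absurd rfl hne, h B hB, (h A hA).symm, hC.disjoint A hA B hB hne]
  ncard_eq := by
    rw [Set.ncard_insert_of_notMem (fun h => hp ⟨{p}, h, rfl⟩) hC.finite, hC.ncard_eq]

theorem IsChainFamily.diff_singleton (hC : IsChainFamily (k + 1) C) (hA : A ∈ C) :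
    IsChainFamily k (C \ {A}) where
  finite := hC.finite.sdiff
  nonempty B hB := hC.nonempty B hB.1
  isChain B hB := hC.isChain B hB.1
  disjoint B hB D hD := hC.disjoint B hB.1 D hD.1
  ncard_eq := by
    rw [Set.ncard_sdiff_singleton_of_mem hA, hC.ncard_eq, Nat.add_sub_cancel]

theorem chainMatching_insert_singleton (hp : p ∉ ⋃₀ C) :
    chainMatching (insert {p} C) = unmatch p (chainMatching C) := by
  have hcovers : ∀ x y, ¬ CoversIn {p} x y := by
    rintro x y ⟨rfl, rfl, h, -⟩
    exact lt_irrefl _ h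
  have hnot : ∀ A ∈ C, ∀ y, ¬ CoversIn A p y := fun A hA _ h => hp ⟨A, hA, h.1⟩
  ext x y
  simp only [chainMatching, unmatch, Set.mem_sUnion, Set.mem_insert_iff, exists_eq_or_imp,
    Set.mem_singleton_iff]
  grind

theorem IsAugmentation.isFamilyAugmentation [WellFoundedLT P] [WellFoundedGT P]
    (h : IsAugmentation (chainMatching C) (chainMatching D)) (hC : IsChainFamily k C)
    (hD : IsChainFamily m D) : IsFamilyAugmentation C D := by
  rcases h with ⟨u, v, w, hw, hpos, hedges⟩ | ⟨p, hp, hunmatch⟩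
  · rw [strictEdges_chainMatching, strictEdges_chainMatching] at hedges
    exact .inl ⟨u, v, w, hw, hpos, hedges⟩
  · rw [loops_chainMatching] at hp
    refine .inr ⟨p, hp, ?_⟩
    rw [← hD.chainFamily_chainMatching, hunmatch, ← chainMatching_insert_singleton hp,
      (hC.insert_singleton hp).chainFamily_chainMatching]

theorem exists_isMaximalChainFamily_isFamilyAugmentation [Finite P]
    (hC : IsMaximalChainFamily k C) (hD : IsMaximalChainFamily (k + 1) D) :
    ∃ C' D', IsMaximalChainFamily (k + 1) C' ∧ IsMaximalChainFamily k D' ∧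
      IsFamilyAugmentation C C' ∧ IsFamilyAugmentation D' D := by
  obtain ⟨M, N, hM, hN, hCM, hND⟩ := exists_isOptimalMatching_isAugmentation
    (hC.1.isMaximalChainFamily_iff.1 hC) (hD.1.isMaximalChainFamily_iff.1 hD)
  obtain ⟨C', hC', rfl⟩ := hM.exists_isMaximalChainFamily
  obtain ⟨D', hD', rfl⟩ := hN.exists_isMaximalChainFamily
  exact ⟨C', D', hC', hD', hCM.isFamilyAugmentation hC.1 hC'.1,
    hND.isFamilyAugmentation hD'.1 hD.1⟩

theorem DiffersByPath.symm (h : DiffersByPath C D) : DiffersByPath D C := by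
  obtain ⟨u, v, w, hw, hpos, hedges⟩ := h
  exact ⟨u, v, w, hw, hpos, by rw [hedges, symmDiff_symmDiff_cancel_right]⟩

theorem IsFamilyAugmentation.differsByPath_or_eq_diff (h : IsFamilyAugmentation C D) :
    DiffersByPath D C ∨ ∃ p, {p} ∈ D ∧ C = D \ {{p}} := by
  refine h.imp DiffersByPath.symm ?_
  rintro ⟨p, hp, rfl⟩
  exact ⟨p, Set.mem_insert _ _, (Set.insert_sdiff_self_of_notMem fun h => hp ⟨{p}, h, rfl⟩).symm⟩

end ChainFamily

end GreeneKleitman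

theorem theorem8p6 {P : Type*} [PartialOrder P] [Finite P] :
    (∀ (k : ℕ) (C : Set (Set P)),
      GreeneKleitman.IsMaximalChainFamily k C → ⋃₀ C ≠ Set.univ →
        ∃ C' : Set (Set P), GreeneKleitman.IsMaximalChainFamily (k + 1) C' ∧
          (GreeneKleitman.DiffersByPath C C' ∨
            ∃ p : P, p ∉ ⋃₀ C ∧ C' = insert {p} C)) ∧
    (∀ (k : ℕ) (C : Set (Set P)),
      GreeneKleitman.IsMaximalChainFamily k C → 0 < k →
        ∃ C' : Set (Set P), GreeneKleitman.IsMaximalChainFamily (k - 1) C' ∧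
          (GreeneKleitman.DiffersByPath C C' ∨
            ∃ p : P, {p} ∈ C ∧ C' = C \ {{p}})) := by
  refine ⟨fun k C hC hne => ?_, fun k C hC hk => ?_⟩
  · obtain ⟨q, hq⟩ := (Set.ne_univ_iff_exists_notMem _).1 hne
    obtain ⟨D, hD⟩ := (hC.1.insert_singleton hq).exists_isMaximalChainFamily
    obtain ⟨C', -, hC', -, h, -⟩ :=
      GreeneKleitman.exists_isMaximalChainFamily_isFamilyAugmentation hC hD
    exact ⟨C', hC', h⟩
  · obtain ⟨k, rfl⟩ := Nat.exists_eq_succ_of_ne_zero hk.ne'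
    obtain ⟨A, hA⟩ : C.Nonempty := Set.nonempty_of_ncard_ne_zero (hC.1.ncard_eq ▸ hk.ne')
    obtain ⟨D, hD⟩ := (hC.1.diff_singleton hA).exists_isMaximalChainFamily
    obtain ⟨-, C', -, hC', -, h⟩ :=
      GreeneKleitman.exists_isMaximalChainFamily_isFamilyAugmentation hD hC
    exact ⟨C', hC', h.differsByPath_or_eq_diff⟩
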